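/- Let $d\ge 1$ and $\gamma>0$, and let $\{\xi(z)\}_{z\in\mathbb{Z}^d}$ be i.i.d. real random variables with $\mathbb{P}(\xi(z)>x)=e^{-x^\gamma}$ for all $x\ge 0$. Write $(\Delta f)(z)=\sum_{y\in\mathbb{Z}^d,\,|y-z|_{\ell^1}=1}f(y)$. Almost surely, the parabolic Anderson model $$\frac{\partial u(t,z)}{\partial t}=(\Delta+\xi)u(t,z),\quad (t,z)\in[0,\infty)\times\mathbb{Z}^d,\qquad u(0,z)=\mathbf 1_{\{0\}}(z),$$ has a unique non-negative solution $u$, and its total mass $U(t)=\sum_{z\in\mathbb{Z}^d}u(t,z)$ is finite for every $t\ge0$. For large $t$ let $R_t=t(\log t)^{1/\gamma}$ and let $V_t=[-R_t,R_t]^d\cap\mathbb{Z}^d$, regarded as a discrete torus, i.e. with each coordinate taken modulo $2\lfloor R_t\rfloor+1$. Let $\Delta_{V_t}f(z)$ be the sum of $f$ over the $2d$ neighbours of $z$ in this torus, and let $u_{V_t}(s,z)$, $s\ge0$, $z\in V_t$, be the unique solution of $\partial_s u_{V_t}=(\Delta_{V_t}+\xi)u_{V_t}$ on $V_t$ with $u_{V_t}(0,z)=\mathbf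 1_{\{0\}}(z)$. Put $u_{V_t}(s,z)=0$ for $z\notin V_t$ and $U_{V_t}(t)=\sum_{z\in V_t}u_{V_t}(t,z)$. Then, almost surely, as $t\to\infty$, $$\sup_{z\in\mathbb{Z}^d}|u_{V_t}(t,z)-u(t,z)|=o(e^{-R_t})\qquad\text{and}\qquad |U_{V_t}(t)-U(t)|=o(e^{-R_t}).$$ In particular, almost surely, $|u_{V_t}(t,z)-u(t,z)|=o(e^{-R_t})$ for every $z\in\mathbb{Z}^d$. -/

import Mathlib

open MeasureTheory ProbabilityTheory Filter Asymptotics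

noncomputable section

namespace PAM

/-- The initial condition: the indicator function of the origin. -/
def originIndicator (d : ℕ) : (Fin d → ℤ) → ℝ := Pi.single 0 1

/-- The discrete Laplacian on `ℤ^d` without diagonal term, `(Δ f)(z) = ∑_{y ∼ z} f(y)`; the
nearest neighbours of `z` are the `2d` sites `z ± e_i`. -/
def laplacian {d : ℕ} (f : (Fin d → ℤ) → ℝ) (z : Fin d → ℤ) : ℝ :=
  ∑ i, (f (z + Pi.single i 1) + f (z - Pi.single i 1))

/-- `u` is a non-negative solution of the parabolic Anderson model on `[0, ∞) × ℤ^d` with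
potential `q`: `∂u/∂t = (Δ + q) u`, `u(0, ·) = 1_{0}`. At `t = 0` the derivative is one-sided;
nothing is asked at negative times. -/
structure IsSolution {d : ℕ} (q : (Fin d → ℤ) → ℝ) (u : ℝ → (Fin d → ℤ) → ℝ) : Prop where
  nonneg : ∀ t, 0 ≤ t → ∀ z, 0 ≤ u t z
  initial : u 0 = originIndicator d
  hasDeriv : ∀ t, 0 ≤ t → ∀ z,
    HasDerivWithinAt (fun s => u s z) (laplacian (u t) z + q z * u t z) (Set.Ici 0) t

/-- The macrobox size `R_t = t (log t)^{1/γ}`. -/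
def radius (γ t : ℝ) : ℝ := t * Real.log t ^ (1 / γ)

/-- The integer part of `R_t`. -/
def intRadius (γ t : ℝ) : ℕ := ⌊radius γ t⌋₊

/-- The sites of the box `[-N, N]^d`. -/
def box (d N : ℕ) : Finset (Fin d → ℤ) :=
  Fintype.piFinset fun _ => Finset.Icc (-(N : ℤ)) N

/-- The unique site of `[-N, N]^d` that is congruent to `z` modulo `2N + 1` in each coordinate
(the balanced remainder). -/
def wrap {d : ℕ} (N : ℕ) (z : Fin d → ℤ) : Fin d → ℤ := fun i => (z i).bmod (2 * N + 1)

/-- The Laplacian on the box `[-N, N]^d` with periodic boundary conditions, i.e. on the torus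
`(ℤ/(2N+1))^d` whose points are represented by the sites of the box. -/
def torusLaplacian {d : ℕ} (N : ℕ) (f : (Fin d → ℤ) → ℝ) (z : Fin d → ℤ) : ℝ :=
  ∑ i, (f (wrap N (z + Pi.single i 1)) + f (wrap N (z - Pi.single i 1)))

/-- `v` solves the parabolic Anderson model on the periodic box `[-N, N]^d` with potential `q`,
and is extended by `0` outside the box. -/
structure IsTorusSolution {d : ℕ} (N : ℕ) (q : (Fin d → ℤ) → ℝ)
    (v : ℝ → (Fin d → ℤ) → ℝ) : Prop where
  zero_outside : ∀ s, 0 ≤ s → ∀ z, z ∉ box d N → v s z = 0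
  initial : v 0 = originIndicator d
  hasDeriv : ∀ s, 0 ≤ s → ∀ z ∈ box d N,
    HasDerivWithinAt (fun r => v r z) (torusLaplacian N (v s) z + q z * v s z) (Set.Ici 0) s

end PAM

end

open scoped NNReal ENNReal Topology

namespace PAM

/-! ### Pointwise bounds along walks for solutions of linear lattice systems -/

section Uniqueness

open Set

/-! Expand exp (t (Δ + ξ)) 1_0 as a power series and sort the words in Δ and ξ by the number m of
letters Δ, that is, by the number of steps of a walk. With at most m steps a walk stays in [-m,
m]^d, so if ξ ≤ M_m there, the layer m has total mass at most (2dt)^m / m! · exp (t M_m)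
(`Exhausts.tsum_layer_le`). For m ≤ ⌊R_t⌋ no walk notices the periodic boundary, and the layers on
the lattice and on the torus coincide (`stepCoeff_congr`). Both differences are therefore bounded by
the sum of the layers m > R_t (`abs_semigroup_sub_le`).

Borel–Cantelli gives, almost surely, ξ ≥ 0 and M_m = C (log (m + 3))^{1/γ} (`ae_le_logGrowth`). If m
≥ R_t, then t M_m = O(m), while m! ≥ (m/e)^m and t/m ≤ (log t)^{-1/γ} → 0; the factorial wins and
the layer is at most exp (-2m) for large t (`eventually_layerBound_le`). The tail is then O(exp (-2
R_t)) = o(exp (-R_t)).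

Uniqueness on the lattice needs no growth condition beyond non-negativity. For ξ ≥ 0, a site n steps
away from z sends at least the fraction τ^n / n! of its mass to z during time τ, so a non-negative
solution is at most c n! / τ^n there. Iterating the equation for the difference of two solutions n
times gains (2ds)^n / n! · exp (s M_n). The factorials cancel, and for large τ the product tends to
0 because M_n is sublinear (`eq_of_nonneg_of_sublinear`). On the torus boundedness suffices
(`eq_of_bounded`). -/

theorem nonneg_of_hasDerivWithinAt_nonneg {f f' : ℝ → ℝ} {a b : ℝ}
    (hf : ∀ t ∈ Icc a b, HasDerivWithinAt f (f' t) (Icc a b) t)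
    (hf' : ∀ t ∈ Icc a b, 0 ≤ f' t) (h0 : 0 ≤ f a) {t : ℝ} (ht : t ∈ Icc a b) : 0 ≤ f t := by
  have hmono : MonotoneOn f (Icc a b) := by
    refine monotoneOn_of_deriv_nonneg (convex_Icc a b)
      (fun x hx => (hf x hx).continuousWithinAt)
      (fun x hx => ((hf x (interior_subset hx)).mono interior_subset).differentiableWithinAt)
      (fun x hx => ?_)
    rw [((hf x (interior_subset hx)).hasDerivAt (mem_interior_iff_mem_nhds.1 hx)).deriv]
    exact hf' x (interior_subset hx)
  exact h0.trans (hmono (left_mem_Icc.2 (ht.1.trans ht.2)) ht ht.1)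

variable {ι V : Type*} [Fintype ι]

/-- The end point of the walk that starts at `z` and performs the steps of `l`. -/
def walk (σ : ι → V → V) : V → List ι → V
  | z, [] => z
  | z, j :: l => walk σ (σ j z) l

theorem hasDerivAt_pow_succ_div_factorial (k : ℕ) (a t : ℝ) :
    HasDerivAt (fun r : ℝ => (a * r) ^ (k + 1) / (k + 1).factorial)
      (a * ((a * t) ^ k / k.factorial)) t := by
  have h := ((((hasDerivAt_id t).const_mul a).pow (k + 1)).div_const ((k + 1).factorial : ℝ))
  refine h.congr_deriv ?_
  have h1 : (k.factorial : ℝ) ≠ 0 := by positivity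
  rw [Nat.factorial_succ]
  push_cast
  simp only [id]
  field_simp

/-- A non-negative solution propagates mass along walks. -/
theorem pow_mul_le_of_walk {σ : ι → V → V} {q : V → ℝ} {v : ℝ → V → ℝ} (hq : ∀ z, 0 ≤ q z)
    (hv : ∀ t, 0 ≤ t → ∀ z, 0 ≤ v t z)
    (hder : ∀ t, 0 ≤ t → ∀ z,
      HasDerivWithinAt (fun s => v s z) (∑ j, v t (σ j z) + q z * v t z) (Ici 0) t)
    {s : ℝ} (hs : 0 ≤ s) (l : List ι) (z : V) {r : ℝ} (hr : s ≤ r) :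
    (r - s) ^ l.length / l.length.factorial * v s (walk σ z l) ≤ v r z := by
  have hsub : ∀ b, Icc s b ⊆ Ici (0 : ℝ) := fun b x hx => hs.trans hx.1
  induction l generalizing z r with
  | nil =>
    have := nonneg_of_hasDerivWithinAt_nonneg (f := fun t => v t z - v s z) (a := s) (b := r)
      (fun t ht => ((hder t (hs.trans ht.1) z).mono (hsub r)).sub_const _)
      (fun t ht => by
        have h0 := hs.trans ht.1
        have := Finset.sum_nonneg fun j (_ : j ∈ Finset.univ) => hv t h0 (σ j z)
        have := mul_nonneg (hq z) (hv t h0 z)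
        linarith) (by simp) (right_mem_Icc.2 hr)
    simp only [walk, List.length_nil]
    simp at this ⊢
    linarith
  | cons j l ih =>
    set c := v s (walk σ z (j :: l)) with hc
    have hd : ∀ t, HasDerivAt (fun r : ℝ => (r - s) ^ (l.length + 1) / (l.length + 1).factorial * c)
        ((t - s) ^ l.length / l.length.factorial * c) t := by
      intro t
      have := (hasDerivAt_pow_succ_div_factorial l.length 1 (t - s)).comp_sub_const t s
      simpa using this.mul_const c
    have := nonneg_of_hasDerivWithinAt_nonneg
      (f := fun t => v t z - (t - s) ^ (l.length + 1) / (l.length + 1).factorial * c)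
      (a := s) (b := r)
      (fun t ht => ((hder t (hs.trans ht.1) z).mono (hsub r)).sub (hd t).hasDerivWithinAt)
      (fun t ht => by
        have h0 := hs.trans ht.1
        have h1 := Finset.single_le_sum (f := fun j => v t (σ j z))
          (fun j _ => hv t h0 (σ j z)) (Finset.mem_univ j)
        have h2 := mul_nonneg (hq z) (hv t h0 z)
        have h3 := ih (σ j z) ht.1
        have h4 : v s (walk σ (σ j z) l) = c := rfl
        rw [h4] at h3
        linarith)
      (by simpa using hv s hs z) (right_mem_Icc.2 hr)
    simp only [List.length_cons]
    linarith

/-- A solution with zero initial condition is controlled by its size at the end points of the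
walks of a given length. -/
theorem abs_le_of_walk {σ : ι → V → V} {q : V → ℝ} {w : ℝ → V → ℝ} (hw0 : ∀ z, w 0 z = 0)
    (hder : ∀ t, 0 ≤ t → ∀ z,
      HasDerivWithinAt (fun s => w s z) (∑ j, w t (σ j z) + q z * w t z) (Ici 0) t)
    {s M B : ℝ} (hB : 0 ≤ B) (k : ℕ) (z : V)
    (hwB : ∀ l : List ι, l.length = k → ∀ r ∈ Icc 0 s, |w r (walk σ z l)| ≤ B)
    (hqM : ∀ l : List ι, l.length ≤ k → q (walk σ z l) ≤ M) (hM : 0 ≤ M) {r : ℝ}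
    (hr : r ∈ Icc 0 s) :
    |w r z| ≤ (Fintype.card ι * r) ^ k / k.factorial * Real.exp (r * M) * B := by
  induction k generalizing z r with
  | zero =>
    have h1 := hwB [] rfl r hr
    have h2 : 1 ≤ Real.exp (r * M) := Real.one_le_exp (mul_nonneg hr.1 hM)
    simp only [walk] at h1
    simp only [pow_zero, Nat.factorial_zero, Nat.cast_one, div_one, one_mul]
    nlinarith
  | succ k ih =>
    set D : ℝ := (Fintype.card ι : ℝ)
    have hD0 : 0 ≤ D := Nat.cast_nonneg _
    have hnb : ∀ t ∈ Icc 0 s, |∑ j, w t (σ j z)| ≤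
        D * ((D * t) ^ k / k.factorial) * Real.exp (t * M) * B := by
      intro t ht
      refine (Finset.abs_sum_le_sum_abs _ _).trans ?_
      have : ∀ j ∈ Finset.univ, |w t (σ j z)| ≤
          (D * t) ^ k / k.factorial * Real.exp (t * M) * B := fun j _ =>
        ih (σ j z) (fun l hl => hwB (j :: l) (by simp [hl]))
          (fun l hl => hqM (j :: l) (by simpa using hl)) ht
      refine (Finset.sum_le_card_nsmul _ _ _ this).trans_eq ?_
      rw [nsmul_eq_mul, Finset.card_univ]
      ring
    have hqz : q z ≤ M := hqM [] (Nat.zero_le _)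
    -- The claimed bound times the integrating factor exp (-t q z), which removes the diagonal term.
    -- The derivative of G dominates that of ± w exp (-t q z), by the induction hypothesis at the
    -- neighbours.
    set G : ℝ → ℝ := fun t => (D * t) ^ (k + 1) / (k + 1).factorial *
      Real.exp (t * (M - q z)) * B with hG
    have hGd : ∀ t, HasDerivAt G ((D * ((D * t) ^ k / k.factorial)) * Real.exp (t * (M - q z)) * B +
        (D * t) ^ (k + 1) / (k + 1).factorial * (Real.exp (t * (M - q z)) * (M - q z)) * B) t := by
      intro t
      have h1 := hasDerivAt_pow_succ_div_factorial k D t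
      have h2 : HasDerivAt (fun t => Real.exp (t * (M - q z)))
          (Real.exp (t * (M - q z)) * (M - q z)) t := by
        simpa using ((hasDerivAt_id t).mul_const (M - q z)).exp
      refine ((h1.mul h2).mul_const B).congr_deriv ?_
      ring
    have hHd : ∀ t ∈ Icc 0 s, HasDerivWithinAt (fun t => w t z * Real.exp (t * -q z))
        ((∑ j, w t (σ j z)) * Real.exp (t * -q z)) (Icc 0 s) t := by
      intro t ht
      have h2 : HasDerivAt (fun t => Real.exp (t * -q z)) (Real.exp (t * -q z) * -q z) t := by
        simpa using ((hasDerivAt_id t).mul_const (-q z)).exp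
      have h1 := (hder t ht.1 z).mono (fun x (hx : x ∈ Icc 0 s) => hx.1)
      refine (h1.mul h2.hasDerivWithinAt).congr_deriv ?_
      ring
    have hexp : ∀ t, Real.exp (t * (M - q z)) = Real.exp (t * M) * Real.exp (t * -q z) := by
      intro t
      rw [← Real.exp_add]
      ring_nf
    have key : ∀ t ∈ Icc 0 s, |(∑ j, w t (σ j z)) * Real.exp (t * -q z)| ≤
        (D * ((D * t) ^ k / k.factorial)) * Real.exp (t * (M - q z)) * B +
        (D * t) ^ (k + 1) / (k + 1).factorial * (Real.exp (t * (M - q z)) * (M - q z)) * B := by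
      intro t ht
      have h0 := ht.1
      have hMq : 0 ≤ M - q z := by linarith
      rw [abs_mul, Real.abs_exp]
      have h1 := mul_le_mul_of_nonneg_right (hnb t ht) (Real.exp_nonneg (t * -q z))
      have h2 : 0 ≤ (D * t) ^ (k + 1) / (k + 1).factorial *
        (Real.exp (t * (M - q z)) * (M - q z)) * B := by positivity
      rw [hexp t] at h2 ⊢
      linarith
    have hfin : |w r z * Real.exp (r * -q z)| ≤ G r := by
      rw [abs_le]
      constructor
      · have := nonneg_of_hasDerivWithinAt_nonneg
          (f := fun t => G t + w t z * Real.exp (t * -q z))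
          (fun t ht => (hGd t).hasDerivWithinAt.add (hHd t ht))
          (fun t ht => by have := (abs_le.1 (key t ht)).1; linarith) (by simp [hG, hw0]) hr
        linarith
      · have := nonneg_of_hasDerivWithinAt_nonneg
          (f := fun t => G t - w t z * Real.exp (t * -q z))
          (fun t ht => (hGd t).hasDerivWithinAt.sub (hHd t ht))
          (fun t ht => by have := (abs_le.1 (key t ht)).2; linarith) (by simp [hG, hw0]) hr
        linarith
    rw [abs_mul, Real.abs_exp] at hfin
    simp only [hG] at hfin
    rw [hexp r] at hfin
    have hpos := Real.exp_pos (r * -q z)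
    refine le_of_mul_le_mul_right (hfin.trans_eq ?_) hpos
    ring

end Uniqueness

/-! ### Walk expansion of exp (t (Δ + q)) f -/

section Series

variable {ι V : Type*} [Fintype ι]

/-- `(Δ + q)^n f`, where `Δ f = ∑ j, f ∘ σ j`. -/
def coeff (σ : ι → V → V) (q f : V → ℝ≥0) : ℕ → V → ℝ≥0
  | 0 => f
  | n + 1 => fun z => q z * coeff σ q f n z + ∑ j, coeff σ q f n (σ j z)

/-- The part of `(Δ + q)^n f` in which `Δ` is chosen exactly `m` times. -/
def stepCoeff (σ : ι → V → V) (q f : V → ℝ≥0) : ℕ → ℕ → V → ℝ≥0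
  | 0, 0 => f
  | 0, _ + 1 => 0
  | n + 1, 0 => fun z => q z * stepCoeff σ q f n 0 z
  | n + 1, m + 1 => fun z =>
      q z * stepCoeff σ q f n (m + 1) z + ∑ j, stepCoeff σ q f n m (σ j z)

/-- The contribution to the solution at time `t` of the walks with `m` steps. -/
noncomputable def layer (σ : ι → V → V) (q f : V → ℝ≥0) (t : ℝ) (m : ℕ) (z : V) : ℝ≥0∞ :=
  ∑' n : ℕ, ENNReal.ofReal (t ^ n / n.factorial) * stepCoeff σ q f n m z

/-- `exp (t (Δ + q)) f`. -/
noncomputable def semigroup (σ : ι → V → V) (q f : V → ℝ≥0) (t : ℝ) (z : V) : ℝ :=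
  ∑' n : ℕ, t ^ n / n.factorial * (coeff σ q f n z : ℝ)

/-- The bound on the mass carried by the walks with `m` steps. -/
noncomputable def layerBound (D : ℝ) (M : ℕ → ℝ) (t : ℝ) (m : ℕ) : ℝ :=
  (D * t) ^ m / m.factorial * Real.exp (t * M m)

variable {σ : ι → V → V} {q f : V → ℝ≥0}

theorem tsum_stepCoeff (n : ℕ) (z : V) :
    ∑' m, (stepCoeff σ q f n m z : ℝ≥0∞) = coeff σ q f n z := by
  induction n generalizing z with
  | zero =>
    rw [tsum_eq_zero_add' ENNReal.summable]
    simp [stepCoeff, coeff]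
  | succ n ih =>
    rw [tsum_eq_zero_add' ENNReal.summable]
    simp only [stepCoeff, coeff, ENNReal.coe_add, ENNReal.coe_mul, ENNReal.ofNNReal_finsetSum]
    rw [ENNReal.tsum_add, ENNReal.tsum_mul_left, ← add_assoc, ← mul_add,
      ← tsum_eq_zero_add' (f := fun m => (stepCoeff σ q f n m z : ℝ≥0∞)) ENNReal.summable, ih,
      Summable.tsum_finsetSum fun _ _ => ENNReal.summable]
    simp only [ih]

theorem tsum_layer (t : ℝ) (z : V) :
    ∑' m, layer σ q f t m z = ∑' n : ℕ, ENNReal.ofReal (t ^ n / n.factorial) * coeff σ q f n z := by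
  simp only [layer]
  rw [ENNReal.tsum_comm]
  simp only [ENNReal.tsum_mul_left, tsum_stepCoeff]

/-- The sets `B m` contain the sites within `m` steps of the support of `f`. -/
structure Exhausts (σ : ι → V → V) (f : V → ℝ≥0) (B : ℕ → Set V) : Prop where
  support : ∀ z, f z ≠ 0 → z ∈ B 0
  mono : Monotone B
  step : ∀ m j z, σ j z ∈ B m → z ∈ B (m + 1)

theorem Exhausts.mem_of_stepCoeff_ne_zero {B : ℕ → Set V} (hB : Exhausts σ f B) (n m : ℕ) (z : V)
    (h : stepCoeff σ q f n m z ≠ 0) : z ∈ B m := by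
  induction n generalizing m z with
  | zero =>
    cases m with
    | zero => exact hB.support z h
    | succ m => simp [stepCoeff] at h
  | succ n ih =>
    cases m with
    | zero => exact ih 0 z (right_ne_zero_of_mul h)
    | succ m =>
      by_cases h1 : stepCoeff σ q f n (m + 1) z = 0
      · simp only [stepCoeff, h1, mul_zero, zero_add] at h
        obtain ⟨j, -, hj⟩ := Finset.exists_ne_zero_of_sum_ne_zero h
        exact hB.step m j z (ih m _ hj)
      · exact ih _ z h1

/-- Each of the words with m letters Δ contributes at most D^m M^(n-m): a factor q costs M on the
support, and Δ multiplies total mass by D = `card ι`, since every step is a bijection. The recursion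
in n is Pascal's rule. -/
theorem Exhausts.tsum_stepCoeff_le {σ : ι → Equiv.Perm V} {B : ℕ → Set V}
    (hB : Exhausts (fun j => σ j) f B) (hf : ∑' z, (f z : ℝ≥0∞) ≤ 1) {M : ℝ≥0} {K : ℕ}
    (hM : ∀ z ∈ B K, q z ≤ M) (n m : ℕ) (hm : m ≤ K) :
    ∑' z, (stepCoeff (fun j => σ j) q f n m z : ℝ≥0∞) ≤
      n.choose m * (Fintype.card ι : ℝ≥0∞) ^ m * (M : ℝ≥0∞) ^ (n - m) := by
  have hmul : ∀ n m, m ≤ K → ∑' z, (q z : ℝ≥0∞) * stepCoeff (fun j => σ j) q f n m z ≤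
      M * ∑' z, (stepCoeff (fun j => σ j) q f n m z : ℝ≥0∞) := by
    intro n m hm
    rw [← ENNReal.tsum_mul_left]
    refine ENNReal.tsum_le_tsum fun z => ?_
    by_cases h : stepCoeff (fun j => σ j) q f n m z = 0
    · simp [h]
    · gcongr
      exact hM z (hB.mono hm (hB.mem_of_stepCoeff_ne_zero n m z h))
  induction n generalizing m with
  | zero =>
    cases m with
    | zero => simpa [stepCoeff] using hf
    | succ m => simp [stepCoeff]
  | succ n ih =>
    cases m with
    | zero =>
      simp only [stepCoeff, ENNReal.coe_mul]
      refine (hmul n 0 hm).trans ?_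
      refine (mul_le_mul_right (ih 0 hm) _).trans_eq ?_
      simp [pow_succ, mul_comm]
    | succ m =>
      simp only [stepCoeff, ENNReal.coe_mul, ENNReal.coe_add, ENNReal.ofNNReal_finsetSum]
      rw [ENNReal.tsum_add, Summable.tsum_finsetSum fun _ _ => ENNReal.summable]
      have h1 : ∀ j, ∑' z, (stepCoeff (fun j => σ j) q f n m (σ j z) : ℝ≥0∞) =
          ∑' z, (stepCoeff (fun j => σ j) q f n m z : ℝ≥0∞) := fun j =>
        (σ j).tsum_eq fun z => (stepCoeff (fun j => σ j) q f n m z : ℝ≥0∞)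
      simp only [h1, Finset.sum_const, Finset.card_univ, nsmul_eq_mul]
      refine (add_le_add ((hmul n (m + 1) hm).trans (mul_le_mul_right (ih (m + 1) hm) _))
        (mul_le_mul_right (ih m (by omega)) _)).trans_eq ?_
      rw [Nat.choose_succ_succ, Nat.add_sub_add_right]
      push_cast
      rcases Nat.lt_or_ge n (m + 1) with h | h
      -- The exponent n - (m + 1) is truncated here, but its binomial coefficient vanishes.
      · rw [Nat.choose_eq_zero_of_lt h]
        simp only [Nat.cast_zero]
        ring
      · obtain ⟨k, rfl⟩ := Nat.exists_eq_add_of_le h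
        have e1 : m + 1 + k - (m + 1) = k := by omega
        have e2 : m + 1 + k - m = k + 1 := by omega
        rw [e1, e2]
        ring

/-- Only n ≥ m contribute; after the shift n = k + m the factor (Dt)^m / m! splits off and the
exponential series of tM remains. -/
theorem hasSum_choose_mul_pow (D M t : ℝ) (m : ℕ) :
    HasSum (fun n : ℕ => t ^ n / n.factorial * (n.choose m * D ^ m * M ^ (n - m)))
      ((D * t) ^ m / m.factorial * Real.exp (t * M)) := by
  have h0 : ∀ n ∉ Set.range (fun k => k + m),
      t ^ n / n.factorial * (n.choose m * D ^ m * M ^ (n - m)) = 0 := by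
    intro n hn
    have : n < m := by
      by_contra h
      exact hn ⟨n - m, by simp; omega⟩
    simp [Nat.choose_eq_zero_of_lt this]
  rw [← (add_left_injective m).hasSum_iff h0]
  have h1 : HasSum (fun n : ℕ => (t * M) ^ n / n.factorial) (Real.exp (t * M)) := by
    rw [Real.exp_eq_exp_ℝ]
    exact NormedSpace.expSeries_div_hasSum_exp (t * M)
  refine (h1.mul_left _).congr_fun fun k => ?_
  have h2 := Nat.add_choose_mul_factorial_mul_factorial k m
  have h3 : ((k + m).choose m : ℝ) = (k + m).factorial / (k.factorial * m.factorial) := by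
    rw [eq_div_iff (by positivity)]
    rw [← mul_assoc]
    exact_mod_cast h2
  simp only [Function.comp, Nat.add_sub_cancel]
  rw [h3]
  have : ((k + m).factorial : ℝ) ≠ 0 := by positivity
  field_simp
  ring

theorem Exhausts.tsum_layer_le {σ : ι → Equiv.Perm V} {B : ℕ → Set V}
    (hB : Exhausts (fun j => σ j) f B) (hf : ∑' z, (f z : ℝ≥0∞) ≤ 1) {M : ℕ → ℝ}
    (hM : ∀ m, ∀ z ∈ B m, q z ≤ M m) (hM0 : ∀ m, 0 ≤ M m) {t : ℝ} (ht : 0 ≤ t) (m : ℕ) :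
    ∑' z, layer (fun j => σ j) q f t m z ≤
      ENNReal.ofReal (layerBound (Fintype.card ι) M t m) := by
  have hs := hasSum_choose_mul_pow (Fintype.card ι) (M m) t m
  have hM0' := hM0 m
  rw [layerBound, ← hs.tsum_eq,
    ENNReal.ofReal_tsum_of_nonneg (fun n => by positivity) hs.summable]
  simp only [layer]
  rw [ENNReal.tsum_comm]
  refine ENNReal.tsum_le_tsum fun n => ?_
  rw [ENNReal.tsum_mul_left, ENNReal.ofReal_mul (by positivity)]
  gcongr
  refine (hB.tsum_stepCoeff_le hf (M := (M m).toNNReal) (K := m) ?_ n m le_rfl).trans_eq ?_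
  · intro z hz
    rw [← NNReal.coe_le_coe, Real.coe_toNNReal _ (hM0 m)]
    exact hM m z hz
  · rw [ENNReal.ofReal_mul (by positivity), ENNReal.ofReal_mul (by positivity),
      ENNReal.ofReal_pow (hM0 m), ENNReal.ofReal_pow (by positivity)]
    simp [ENNReal.ofReal]

/-- Termwise differentiation of an exponential generating function. -/
theorem hasDerivAt_tsum_pow_div_factorial {c : ℕ → ℝ} (hc : ∀ n, 0 ≤ c n)
    (hs : ∀ T : ℝ, 0 ≤ T → Summable fun n : ℕ => T ^ n / n.factorial * c n) (t : ℝ) :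
    HasDerivAt (fun t : ℝ => ∑' n : ℕ, t ^ n / n.factorial * c n)
      (∑' n : ℕ, t ^ n / n.factorial * c (n + 1)) t := by
  set T : ℝ := |t| + 1 with hT
  have hT1 : 1 ≤ T := by have := abs_nonneg t; linarith
  have hT0 : 0 ≤ T := by linarith
  have hsucc : Summable fun n : ℕ => T ^ n / n.factorial * c (n + 1) := by
    -- Doubling the radius absorbs the factor n + 1 ≤ 2^(n+1) produced by differentiation.
    have h1 := (summable_nat_add_iff 1).2 (hs (2 * T) (by positivity))
    refine h1.of_nonneg_of_le (fun n => mul_nonneg (by positivity) (hc _)) fun n => ?_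
    refine mul_le_mul_of_nonneg_right ?_ (hc _)
    have h2 : ((n + 1 : ℕ) : ℝ) ≤ 2 ^ (n + 1) := by exact_mod_cast Nat.lt_two_pow_self.le
    have h3 : T ^ n ≤ T ^ (n + 1) := pow_le_pow_right₀ hT1 (Nat.le_succ n)
    rw [div_le_div_iff₀ (by positivity) (by positivity), Nat.factorial_succ, mul_pow]
    push_cast at h2 ⊢
    have h4 : T ^ n * (n + 1) ≤ T ^ (n + 1) * 2 ^ (n + 1) := by gcongr
    have h5 := mul_le_mul_of_nonneg_right h4 (Nat.cast_nonneg (α := ℝ) n.factorial)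
    linarith
  have hb : Summable fun n : ℕ => n * T ^ (n - 1) / n.factorial * c n := by
    rw [← summable_nat_add_iff 1]
    refine hsucc.congr fun n => ?_
    rw [Nat.factorial_succ]
    push_cast
    field_simp
  have hd : HasDerivAt (fun t : ℝ => ∑' n : ℕ, t ^ n / n.factorial * c n)
      (∑' n : ℕ, n * t ^ (n - 1) / n.factorial * c n) t := by
    refine hasDerivAt_tsum_of_isPreconnected (t := Set.Ioo (-T) T) (y₀ := 0)
      (g := fun (n : ℕ) t => t ^ n / n.factorial * c n)
      (g' := fun (n : ℕ) t => n * t ^ (n - 1) / n.factorial * c n) hb isOpen_Ioo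
      isPreconnected_Ioo (fun n y _ => ((hasDerivAt_pow n y).div_const _).mul_const _)
      (fun n y hy => ?_) (by constructor <;> linarith) (hs 0 le_rfl)
      (by have := abs_lt.1 (show |t| < T by linarith); exact this)
    rw [norm_mul, norm_div, norm_mul, norm_pow, Real.norm_of_nonneg (hc n), Real.norm_natCast,
      Real.norm_natCast]
    have : ‖y‖ ≤ T := (abs_lt.2 hy).le
    have := hc n
    gcongr
  refine hd.congr_deriv ?_
  have hsm : Summable fun n : ℕ => n * t ^ (n - 1) / n.factorial * c n := by
    refine Summable.of_norm_bounded hb fun n => ?_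
    rw [norm_mul, norm_div, norm_mul, norm_pow, Real.norm_of_nonneg (hc n), Real.norm_natCast,
      Real.norm_natCast]
    have : ‖t‖ ≤ T := by rw [Real.norm_eq_abs]; linarith
    have := hc n
    gcongr
  rw [hsm.tsum_eq_zero_add]
  simp only [Nat.cast_zero, zero_mul, zero_div, zero_add, Nat.add_sub_cancel]
  refine tsum_congr fun n => ?_
  rw [Nat.factorial_succ]
  push_cast
  field_simp

/-- The hypotheses under which the series for `exp (t (Δ + q)) f` converges. -/
structure Controlled (σ : ι → Equiv.Perm V) (q f : V → ℝ≥0) (B : ℕ → Set V) (M : ℕ → ℝ) :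
    Prop where
  exhausts : Exhausts (fun j => σ j) f B
  mass_le : ∑' z, (f z : ℝ≥0∞) ≤ 1
  le : ∀ m, ∀ z ∈ B m, q z ≤ M m
  nonneg : ∀ m, 0 ≤ M m
  summable : ∀ t, 0 ≤ t → Summable (layerBound (Fintype.card ι) M t)

/-! ### The convergent series solves the equation and has finite total mass -/

namespace Controlled

variable {σ : ι → Equiv.Perm V} {B : ℕ → Set V} {M : ℕ → ℝ}

theorem tsum_tsum_layer_le (h : Controlled σ q f B M) {t : ℝ} (ht : 0 ≤ t) (k : ℕ) :
    ∑' z, ∑' m, layer (fun j => σ j) q f t (m + k) z ≤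
      ENNReal.ofReal (∑' m, layerBound (Fintype.card ι) M t (m + k)) := by
  rw [ENNReal.tsum_comm, ENNReal.ofReal_tsum_of_nonneg
    (fun n => by unfold layerBound; positivity) ((summable_nat_add_iff k).2 (h.summable t ht))]
  exact ENNReal.tsum_le_tsum fun m => h.exhausts.tsum_layer_le h.mass_le h.le h.nonneg ht (m + k)

theorem tsum_tsum_layer_lt_top (h : Controlled σ q f B M) {t : ℝ} (ht : 0 ≤ t) :
    ∑' z, ∑' m, layer (fun j => σ j) q f t m z < ∞ :=
  (h.tsum_tsum_layer_le ht 0).trans_lt ENNReal.ofReal_lt_top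

theorem tsum_layer_lt_top (h : Controlled σ q f B M) {t : ℝ} (ht : 0 ≤ t) (z : V) :
    ∑' m, layer (fun j => σ j) q f t m z < ∞ :=
  (ENNReal.le_tsum z).trans_lt (h.tsum_tsum_layer_lt_top ht)

theorem summable_coeff (h : Controlled σ q f B M) {t : ℝ} (ht : 0 ≤ t) (z : V) :
    Summable fun n : ℕ => t ^ n / n.factorial * (coeff (fun j => σ j) q f n z : ℝ) := by
  have h1 := h.tsum_layer_lt_top ht z
  rw [tsum_layer] at h1
  have := ENNReal.summable_toReal h1.ne
  refine this.congr fun n => ?_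
  rw [ENNReal.toReal_mul, ENNReal.toReal_ofReal (by positivity), ENNReal.coe_toReal]

theorem ofReal_semigroup (h : Controlled σ q f B M) {t : ℝ} (ht : 0 ≤ t) (z : V) :
    ENNReal.ofReal (semigroup (fun j => σ j) q f t z) = ∑' m, layer (fun j => σ j) q f t m z := by
  rw [tsum_layer, semigroup,
    ENNReal.ofReal_tsum_of_nonneg (fun n => by positivity) (h.summable_coeff ht z)]
  refine tsum_congr fun n => ?_
  rw [ENNReal.ofReal_mul (by positivity), ENNReal.ofReal_coe_nnreal]

theorem semigroup_nonneg {t : ℝ} (ht : 0 ≤ t) (z : V) :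
    0 ≤ semigroup (fun j => σ j) q f t z :=
  tsum_nonneg fun n => by positivity

theorem summable_semigroup (h : Controlled σ q f B M) {t : ℝ} (ht : 0 ≤ t) :
    Summable (semigroup (fun j => σ j) q f t) := by
  refine (ENNReal.summable_toReal (h.tsum_tsum_layer_lt_top ht).ne).congr fun z => ?_
  rw [← h.ofReal_semigroup ht, ENNReal.toReal_ofReal (semigroup_nonneg ht z)]

theorem ofReal_tsum_semigroup (h : Controlled σ q f B M) {t : ℝ} (ht : 0 ≤ t) :
    ENNReal.ofReal (∑' z, semigroup (fun j => σ j) q f t z) =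
      ∑' z, ∑' m, layer (fun j => σ j) q f t m z := by
  rw [ENNReal.ofReal_tsum_of_nonneg (semigroup_nonneg ht) (h.summable_semigroup ht)]
  exact tsum_congr fun z => h.ofReal_semigroup ht z

theorem semigroup_zero (z : V) : semigroup (fun j => σ j) q f 0 z = f z := by
  rw [semigroup, tsum_eq_single 0 fun n hn => by simp [hn]]
  simp [coeff]

theorem hasDerivAt_semigroup (h : Controlled σ q f B M) {t : ℝ} (ht : 0 ≤ t) (z : V) :
    HasDerivAt (fun s => semigroup (fun j => σ j) q f s z)
      (∑ j, semigroup (fun j => σ j) q f t (σ j z) + q z * semigroup (fun j => σ j) q f t z) t := by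
  refine (hasDerivAt_tsum_pow_div_factorial (fun n => NNReal.coe_nonneg _)
    (fun T hT => h.summable_coeff hT z) t).congr_deriv ?_
  simp only [semigroup]
  rw [← tsum_mul_left, ← Summable.tsum_finsetSum fun j _ => h.summable_coeff ht (σ j z),
    ← Summable.tsum_add (summable_sum fun j _ => h.summable_coeff ht (σ j z))
      ((h.summable_coeff ht z).mul_left _)]
  refine tsum_congr fun n => ?_
  simp only [coeff, NNReal.coe_add, NNReal.coe_mul, NNReal.coe_sum]
  rw [← Finset.mul_sum]
  ring

theorem semigroup_eq_zero (h : Controlled σ q f B M) {t : ℝ} (ht : 0 ≤ t) {z : V}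
    (hz : ∀ m, z ∉ B m) : semigroup (fun j => σ j) q f t z = 0 := by
  have h1 := h.ofReal_semigroup ht z
  have h2 : ∀ m, layer (fun j => σ j) q f t m z = 0 := by
    intro m
    simp only [layer, ENNReal.tsum_eq_zero, mul_eq_zero]
    intro n
    right
    by_contra hne
    exact hz m (h.exhausts.mem_of_stepCoeff_ne_zero n m z (by exact_mod_cast hne))
  simp only [h2, tsum_zero, ENNReal.ofReal_eq_zero] at h1
  exact le_antisymm h1 (semigroup_nonneg ht z)

end Controlled

/-- A layer with m ≤ N steps sees the potential only on `B N`, and only those steps that land in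
some `B m` with m < N; elsewhere both sides vanish. -/
theorem stepCoeff_congr {σ σ' : ι → V → V} {q q' : V → ℝ≥0} {B : ℕ → Set V} {N : ℕ}
    (hB : Exhausts σ f B) (hq : ∀ z ∈ B N, q z = q' z)
    (hσ : ∀ m < N, ∀ j z, σ j z ∈ B m ∨ σ' j z ∈ B m → σ j z = σ' j z) (n m : ℕ) (hm : m ≤ N)
    (z : V) : stepCoeff σ q f n m z = stepCoeff σ' q' f n m z := by
  have hmul : ∀ n m, m ≤ N → ∀ z,
      q z * stepCoeff σ q f n m z = q' z * stepCoeff σ q f n m z := by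
    intro n m hm z
    by_cases h : stepCoeff σ q f n m z = 0
    · simp [h]
    · rw [hq z (hB.mono hm (hB.mem_of_stepCoeff_ne_zero n m z h))]
  induction n generalizing m z with
  | zero => cases m <;> rfl
  | succ n ih =>
    cases m with
    | zero =>
      simp only [stepCoeff]
      rw [hmul n 0 hm, ih 0 hm]
    | succ m =>
      simp only [stepCoeff]
      rw [hmul n _ hm, ih _ hm]
      congr 1
      refine Finset.sum_congr rfl fun j _ => ?_
      rw [← ih m (by omega)]
      by_cases h : σ j z ∈ B m ∨ σ' j z ∈ B m
      · rw [hσ m (by omega) j z h]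
      · push Not at h
        rw [not_imp_comm.1 (hB.mem_of_stepCoeff_ne_zero (q := q) n m _) h.1,
          not_imp_comm.1 (hB.mem_of_stepCoeff_ne_zero (q := q) n m _) h.2]

/-- Two numbers with a common head H differ by at most the larger tail; arguing by inequalities
avoids subtraction in `ℝ≥0∞`. -/
theorem abs_sub_le_of_ofReal_eq_add {x y ε : ℝ} {H T T' : ℝ≥0∞} (hx0 : 0 ≤ x) (hy0 : 0 ≤ y)
    (hε : 0 ≤ ε) (hx : ENNReal.ofReal x = H + T) (hy : ENNReal.ofReal y = H + T')
    (hT : T ≤ ENNReal.ofReal ε) (hT' : T' ≤ ENNReal.ofReal ε) : |x - y| ≤ ε := by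
  have key : ∀ {x y : ℝ} {T T' : ℝ≥0∞}, 0 ≤ y → ENNReal.ofReal x = H + T →
      ENNReal.ofReal y = H + T' → T ≤ ENNReal.ofReal ε → x ≤ y + ε := by
    intro x y T T' hy0 hx hy hT
    rw [← ENNReal.ofReal_le_ofReal_iff (by positivity), hx, ENNReal.ofReal_add hy0 hε, hy]
    exact add_le_add le_self_add hT
  rw [abs_sub_le_iff]
  constructor
  · linarith [key hy0 hx hy hT]
  · linarith [key hx0 hy hx hT']

/-- Two semigroups that agree up to `N` steps differ by the contribution of longer walks. -/
theorem abs_semigroup_sub_le {σ σ' : ι → Equiv.Perm V} {q q' : V → ℝ≥0} {B B' : ℕ → Set V}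
    {M : ℕ → ℝ} (h : Controlled σ q f B M) (h' : Controlled σ' q' f B' M) {N : ℕ}
    (hq : ∀ z ∈ B N, q z = q' z)
    (hσ : ∀ m < N, ∀ j z, σ j z ∈ B m ∨ σ' j z ∈ B m → σ j z = σ' j z) {t : ℝ} (ht : 0 ≤ t) :
    (∀ z, |semigroup (fun j => σ j) q f t z - semigroup (fun j => σ' j) q' f t z| ≤
      ∑' m, layerBound (Fintype.card ι) M t (m + (N + 1))) ∧
    |∑' z, semigroup (fun j => σ j) q f t z - ∑' z, semigroup (fun j => σ' j) q' f t z| ≤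
      ∑' m, layerBound (Fintype.card ι) M t (m + (N + 1)) := by
  have hε : 0 ≤ ∑' m, layerBound (Fintype.card ι) M t (m + (N + 1)) :=
    tsum_nonneg fun m => by unfold layerBound; positivity
  have hsplit : ∀ (σ : ι → V → V) q z, ∑' m, layer σ q f t m z =
      ∑ m ∈ Finset.range (N + 1), layer σ q f t m z + ∑' m, layer σ q f t (m + (N + 1)) z :=
    fun σ q z => (Summable.sum_add_tsum_nat_add' ENNReal.summable).symm
  have hhead : ∀ z, ∑ m ∈ Finset.range (N + 1), layer (fun j => σ' j) q' f t m z =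
      ∑ m ∈ Finset.range (N + 1), layer (fun j => σ j) q f t m z := by
    intro z
    refine Finset.sum_congr rfl fun m hm => ?_
    simp only [layer]
    refine tsum_congr fun n => ?_
    rw [stepCoeff_congr h.exhausts hq hσ n m (by simpa [Nat.lt_succ_iff] using hm) z]
  have h1 := h.tsum_tsum_layer_le ht (N + 1)
  have h2 := h'.tsum_tsum_layer_le ht (N + 1)
  constructor
  · intro z
    refine abs_sub_le_of_ofReal_eq_add
      (H := ∑ m ∈ Finset.range (N + 1), layer (fun j => σ j) q f t m z)
      (Controlled.semigroup_nonneg ht z)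
      (Controlled.semigroup_nonneg ht z) hε ((h.ofReal_semigroup ht z).trans (hsplit _ _ z))
      ((h'.ofReal_semigroup ht z).trans ((hsplit _ _ z).trans (by rw [hhead])))
      ((ENNReal.le_tsum z).trans h1) ((ENNReal.le_tsum z).trans h2)
  · refine abs_sub_le_of_ofReal_eq_add (tsum_nonneg (Controlled.semigroup_nonneg ht))
      (tsum_nonneg (Controlled.semigroup_nonneg ht)) hε
      (H := ∑' z, ∑ m ∈ Finset.range (N + 1), layer (fun j => σ j) q f t m z)
      ((h.ofReal_tsum_semigroup ht).trans ?_)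
      ((h'.ofReal_tsum_semigroup ht).trans ?_) h1 h2
    · simp only [hsplit, ENNReal.tsum_add]
    · simp only [hsplit, ENNReal.tsum_add, hhead]

end Series

/-! ### Uniqueness of solutions -/

section UniquenessTheorems

open Set

variable {ι V : Type*} [Fintype ι]

theorem hasDerivWithinAt_sub_of_linear {σ : ι → V → V} {q : V → ℝ} {v v' : ℝ → V → ℝ}
    (hder : ∀ t, 0 ≤ t → ∀ z,
      HasDerivWithinAt (fun s => v s z) (∑ j, v t (σ j z) + q z * v t z) (Ici 0) t)
    (hder' : ∀ t, 0 ≤ t → ∀ z,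
      HasDerivWithinAt (fun s => v' s z) (∑ j, v' t (σ j z) + q z * v' t z) (Ici 0) t) :
    ∀ t, 0 ≤ t → ∀ z, HasDerivWithinAt (fun s => (fun s z => v s z - v' s z) s z)
      (∑ j, (fun s z => v s z - v' s z) t (σ j z) + q z * (fun s z => v s z - v' s z) t z)
      (Ici 0) t := by
  intro t ht z
  refine ((hder t ht z).sub (hder' t ht z)).congr_deriv ?_
  simp only [Finset.sum_sub_distrib]
  ring

/-- Uniqueness of non-negative solutions for potentials of sublinear growth. -/
theorem eq_of_nonneg_of_sublinear {σ : ι → V → V} {q : V → ℝ} {v v' : ℝ → V → ℝ}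
    (hq : ∀ z, 0 ≤ q z) (h0 : ∀ z, v 0 z = v' 0 z)
    (hv : ∀ t, 0 ≤ t → ∀ z, 0 ≤ v t z) (hv' : ∀ t, 0 ≤ t → ∀ z, 0 ≤ v' t z)
    (hder : ∀ t, 0 ≤ t → ∀ z,
      HasDerivWithinAt (fun s => v s z) (∑ j, v t (σ j z) + q z * v t z) (Ici 0) t)
    (hder' : ∀ t, 0 ≤ t → ∀ z,
      HasDerivWithinAt (fun s => v' s z) (∑ j, v' t (σ j z) + q z * v' t z) (Ici 0) t)
    (z : V) {M : ℕ → ℝ} (hM0 : ∀ n, 0 ≤ M n)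
    (hM : ∀ n, ∀ l : List ι, l.length ≤ n → q (walk σ z l) ≤ M n)
    (hMo : ∀ ε : ℝ, 0 < ε → ∀ᶠ n : ℕ in atTop, M n ≤ ε * n) {s : ℝ} (hs : 0 ≤ s) :
    v s z = v' s z := by
  set D : ℝ := (Fintype.card ι : ℝ) with hD
  have hD0 : 0 ≤ D := Nat.cast_nonneg _
  -- Makes D s / τ at most exp (-2); the summand 1 keeps τ positive when D s = 0.
  set τ : ℝ := Real.exp 2 * (D * s) + 1 with hτ
  have hτ0 : 0 < τ := by positivity
  have hDs : D * s ≤ τ * Real.exp (-2) := by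
    have : Real.exp 2 * Real.exp (-2) = 1 := by rw [← Real.exp_add]; simp
    have h2 := Real.exp_pos (-2)
    have h3 : τ * Real.exp (-2) = D * s * (Real.exp 2 * Real.exp (-2)) + Real.exp (-2) := by
      rw [hτ]
      ring
    rw [h3, this]
    linarith
  set c : ℝ := v (s + τ) z + v' (s + τ) z with hc
  have hc0 : 0 ≤ c := add_nonneg (hv _ (by positivity) z) (hv' _ (by positivity) z)
  have hbound : ∀ n : ℕ, |v s z - v' s z| ≤ c * Real.exp (s * M n - 2 * n) := by
    intro n
    have hB : 0 ≤ c * (n.factorial / τ ^ n) := by positivity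
    have h1 := abs_le_of_walk (w := fun s z => v s z - v' s z) (s := s) (M := M n)
      (fun z => sub_eq_zero.2 (h0 z)) (hasDerivWithinAt_sub_of_linear hder hder') hB n z
      (fun l hl r hr => ?_) (hM n) (hM0 n) (right_mem_Icc.2 hs)
    · refine h1.trans ?_
      have h2 : (D * s) ^ n ≤ (τ * Real.exp (-2)) ^ n := by gcongr
      have h3 : Real.exp (s * M n - 2 * n) = Real.exp (s * M n) * Real.exp (-2) ^ n := by
        rw [← Real.exp_nat_mul, ← Real.exp_add]
        ring_nf
      rw [h3]
      calc (D * s) ^ n / n.factorial * Real.exp (s * M n) * (c * (n.factorial / τ ^ n))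
          ≤ (τ * Real.exp (-2)) ^ n / n.factorial * Real.exp (s * M n) *
            (c * (n.factorial / τ ^ n)) := by gcongr
        _ = c * (Real.exp (s * M n) * Real.exp (-2) ^ n) := by
          rw [mul_pow]
          field_simp
    -- A priori bound: a time of at least τ separates r from s + τ, enough to carry the mass at the
    -- end of the walk back to z.
    · have hrT : r ≤ s + τ := by linarith [hr.2]
      have e1 := pow_mul_le_of_walk hq hv hder hr.1 l z hrT
      have e2 := pow_mul_le_of_walk hq hv' hder' hr.1 l z hrT
      have a1 := hv r hr.1 (walk σ z l)
      have a2 := hv' r hr.1 (walk σ z l)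
      rw [hl] at e1 e2
      have e3 : (v r (walk σ z l) + v' r (walk σ z l)) * (τ ^ n / n.factorial) ≤ c := by
        have e4 : τ ^ n / n.factorial ≤ (s + τ - r) ^ n / n.factorial := by
          have : τ ≤ s + τ - r := by linarith [hr.2]
          gcongr
        have := mul_le_mul_of_nonneg_left e4 (add_nonneg a1 a2)
        rw [hc]
        linarith
      have e5 : |v r (walk σ z l) - v' r (walk σ z l)| ≤
          v r (walk σ z l) + v' r (walk σ z l) := by
        rw [abs_le]
        constructor <;> linarith
      refine e5.trans ?_
      rwa [← inv_div (τ ^ n), ← div_eq_mul_inv, le_div_iff₀ (by positivity)]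
  have hlim : Tendsto (fun n : ℕ => c * Real.exp (-(n : ℝ))) atTop (𝓝 (c * 0)) :=
    (Real.tendsto_exp_neg_atTop_nhds_zero.comp tendsto_natCast_atTop_atTop).const_mul c
  rw [mul_zero] at hlim
  have : |v s z - v' s z| ≤ 0 := by
    refine ge_of_tendsto hlim ?_
    -- With this slope s M n ≤ n, so the exponent s M n - 2n is at most -n.
    filter_upwards [hMo (1 / (s + 1)) (by positivity)] with n hn
    refine (hbound n).trans ?_
    gcongr
    have h1 : s * M n ≤ (s + 1) * M n := by have := hM0 n; nlinarith
    have h2 : (s + 1) * M n ≤ n := by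
      have := mul_le_mul_of_nonneg_left hn (show (0 : ℝ) ≤ s + 1 by positivity)
      rwa [← mul_assoc, mul_one_div_cancel (by positivity), one_mul] at this
    linarith
  exact sub_eq_zero.1 (abs_nonpos_iff.1 this)

/-- Uniqueness of bounded solutions for bounded potentials. -/
theorem eq_of_bounded {σ : ι → V → V} {q : V → ℝ} {v v' : ℝ → V → ℝ}
    (h0 : ∀ z, v 0 z = v' 0 z)
    (hder : ∀ t, 0 ≤ t → ∀ z,
      HasDerivWithinAt (fun s => v s z) (∑ j, v t (σ j z) + q z * v t z) (Ici 0) t)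
    (hder' : ∀ t, 0 ≤ t → ∀ z,
      HasDerivWithinAt (fun s => v' s z) (∑ j, v' t (σ j z) + q z * v' t z) (Ici 0) t)
    {M B s : ℝ} (hM0 : 0 ≤ M) (hM : ∀ z, q z ≤ M) (hs : 0 ≤ s)
    (hB : ∀ r ∈ Icc 0 s, ∀ z, |v r z - v' r z| ≤ B) (z : V) :
    v s z = v' s z := by
  have hB0 : 0 ≤ B := (abs_nonneg _).trans (hB s (right_mem_Icc.2 hs) z)
  have hbound : ∀ n : ℕ, |v s z - v' s z| ≤
      (Fintype.card ι * s) ^ n / n.factorial * Real.exp (s * M) * B := fun n =>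
    abs_le_of_walk (w := fun s z => v s z - v' s z) (s := s) (fun z => sub_eq_zero.2 (h0 z))
      (hasDerivWithinAt_sub_of_linear hder hder') hB0 n z (fun l _ r hr => hB r hr _)
      (fun l _ => hM _) hM0 (right_mem_Icc.2 hs)
  have hlim := ((FloorSemiring.tendsto_pow_div_factorial_atTop
    ((Fintype.card ι : ℝ) * s)).mul_const (Real.exp (s * M))).mul_const B
  simp only [zero_mul] at hlim
  exact sub_eq_zero.1 (abs_nonpos_iff.1 (ge_of_tendsto hlim (Eventually.of_forall hbound)))

end UniquenessTheorems

/-! ### Growth of the potential bound and decay of the long-walk layers -/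

section Asymptotics

theorem summable_layerBound {D t : ℝ} (hD : 0 ≤ D) (ht : 0 ≤ t) {M : ℕ → ℝ} (hM0 : ∀ n, 0 ≤ M n)
    (hMo : ∀ ε : ℝ, 0 < ε → ∀ᶠ n : ℕ in atTop, M n ≤ ε * n) : Summable (layerBound D M t) := by
  refine summable_of_isBigO_nat (Real.summable_pow_div_factorial (D * t * Real.exp 1)) ?_
  refine IsBigO.of_bound 1 ?_
  filter_upwards [hMo (1 / (t + 1)) (by positivity)] with n hn
  have h1 : t * M n ≤ (t + 1) * M n := by have := hM0 n; nlinarith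
  have h2 : (t + 1) * M n ≤ n := by
    have := mul_le_mul_of_nonneg_left hn (show (0 : ℝ) ≤ t + 1 by positivity)
    rwa [← mul_assoc, mul_one_div_cancel (by positivity), one_mul] at this
  rw [one_mul, layerBound, Real.norm_of_nonneg (by positivity), Real.norm_of_nonneg (by positivity),
    mul_pow _ (Real.exp 1), ← Real.exp_nat_mul, mul_one, mul_div_right_comm]
  gcongr
  linarith

/-- The growth of the potential: `C (log (m + 3)) ^ p`. -/
noncomputable def logGrowth (C p : ℝ) (m : ℕ) : ℝ := C * Real.log (m + 3) ^ p

theorem log_add_three_nonneg (m : ℕ) : 0 ≤ Real.log ((m : ℝ) + 3) :=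
  Real.log_nonneg (by have := Nat.cast_nonneg (α := ℝ) m; linarith)

theorem logGrowth_nonneg {C : ℝ} (hC : 0 ≤ C) (p : ℝ) (m : ℕ) : 0 ≤ logGrowth C p m :=
  mul_nonneg hC (Real.rpow_nonneg (log_add_three_nonneg m) p)

theorem logGrowth_mono {C p : ℝ} (hC : 0 ≤ C) (hp : 0 ≤ p) : Monotone (logGrowth C p) := by
  intro m n hmn
  have h1 : (m : ℝ) ≤ n := by exact_mod_cast hmn
  have h2 := log_add_three_nonneg m
  unfold logGrowth
  gcongr

theorem eventually_log_rpow_le (p : ℝ) {s ε : ℝ} (hs : 0 < s) (hε : 0 < ε) :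
    ∀ᶠ x : ℝ in atTop, Real.log (x + 3) ^ p ≤ ε * x ^ s := by
  have h1 := (isLittleO_log_rpow_rpow_atTop p hs).def (c := ε / 4 ^ s) (by positivity)
  have h2 := (tendsto_atTop_add_const_right atTop (3 : ℝ) tendsto_id).eventually h1
  filter_upwards [h2, eventually_ge_atTop 1] with x hx hx1
  simp only [id] at hx
  refine (le_abs_self _).trans (hx.trans ?_)
  rw [Real.norm_of_nonneg (by positivity)]
  have h3 : (x + 3) ^ s ≤ (4 * x) ^ s := by gcongr; linarith
  rw [Real.mul_rpow (by norm_num) (by linarith)] at h3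
  calc ε / 4 ^ s * (x + 3) ^ s ≤ ε / 4 ^ s * (4 ^ s * x ^ s) := by gcongr
    _ = ε * x ^ s := by field_simp

/-- The offset k serves walks that start at a site of the box of size k instead of the origin. -/
theorem logGrowth_add_sublinear {C : ℝ} (hC : 0 ≤ C) (p : ℝ) (k : ℕ) {ε : ℝ} (hε : 0 < ε) :
    ∀ᶠ n : ℕ in atTop, logGrowth C p (k + n) ≤ ε * n := by
  have h1 := eventually_log_rpow_le p zero_lt_one (show 0 < ε / (2 * (C + 1)) by positivity)
  have h2 : Tendsto (fun n : ℕ => ((k + n : ℕ) : ℝ)) atTop atTop :=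
    tendsto_natCast_atTop_atTop.comp (tendsto_add_atTop_nat k |>.congr fun n => add_comm n k)
  filter_upwards [h2.eventually h1, eventually_ge_atTop k] with n hn hk
  have hk' : (k : ℝ) ≤ n := by exact_mod_cast hk
  rw [Real.rpow_one] at hn
  have hpos : 0 ≤ Real.log (((k + n : ℕ) : ℝ) + 3) ^ p :=
    Real.rpow_nonneg (log_add_three_nonneg _) p
  unfold logGrowth
  calc C * Real.log (((k + n : ℕ) : ℝ) + 3) ^ p
      ≤ (C + 1) * Real.log (((k + n : ℕ) : ℝ) + 3) ^ p := by gcongr; linarith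
    _ ≤ (C + 1) * (ε / (2 * (C + 1)) * ((k + n : ℕ) : ℝ)) := by gcongr
    _ = ε * ((k + n) / 2) := by push_cast; field_simp
    _ ≤ ε * n := by gcongr; linarith

theorem tendsto_radius {γ : ℝ} (hγ : 0 < γ) : Tendsto (radius γ) atTop atTop := by
  refine tendsto_atTop_mono' _ ?_ tendsto_id
  filter_upwards [Real.tendsto_log_atTop.eventually_ge_atTop 1, eventually_ge_atTop 0] with t h1 h0
  exact le_mul_of_one_le_right h0 (Real.one_le_rpow h1 (by positivity))

/-- If m ≤ t², then log (m + 3) ≤ 3 log t, so the left side is at most 3^{1/γ} R_t. If m ≥ t², then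
t ≤ √m, and the power of the logarithm is at most √m as well. -/
theorem eventually_mul_log_rpow_le {γ : ℝ} (hγ : 0 < γ) :
    ∀ᶠ t : ℝ in atTop, ∀ m : ℕ, radius γ t ≤ m →
      t * Real.log (m + 3) ^ (1 / γ) ≤ (3 ^ (1 / γ) + 1) * m := by
  have hp : 0 < 1 / γ := by positivity
  obtain ⟨x₀, hx₀⟩ := eventually_atTop.1
    (eventually_log_rpow_le (1 / γ) (show (0 : ℝ) < 1 / 2 by norm_num) zero_lt_one)
  filter_upwards [Real.tendsto_log_atTop.eventually_ge_atTop 1, eventually_ge_atTop 3,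
    eventually_ge_atTop x₀] with t h1 h3 hx m hm
  have htm : t ≤ m := by
    refine le_trans ?_ hm
    exact le_mul_of_one_le_right (by linarith) (Real.one_le_rpow h1 hp.le)
  have hm0 : (0 : ℝ) ≤ m := by linarith
  have h30 : (0 : ℝ) ≤ 3 ^ (1 / γ) := by positivity
  rcases le_total (m : ℝ) (t ^ 2) with hmt | hmt
  · have hlog : Real.log (m + 3) ≤ 3 * Real.log t := by
      rw [show (3 : ℝ) * Real.log t = Real.log (t ^ 3) by rw [Real.log_pow]; norm_num]
      refine Real.log_le_log (by linarith) ?_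
      nlinarith [sq_nonneg t]
    have hl0 := log_add_three_nonneg m
    calc t * Real.log (m + 3) ^ (1 / γ) ≤ t * (3 * Real.log t) ^ (1 / γ) := by gcongr
      _ = 3 ^ (1 / γ) * radius γ t := by
        rw [Real.mul_rpow (by norm_num) (by linarith), radius]
        ring
      _ ≤ 3 ^ (1 / γ) * m := by gcongr
      _ ≤ (3 ^ (1 / γ) + 1) * m := by nlinarith
  · have h4 := hx₀ m (by linarith)
    rw [one_mul, ← Real.sqrt_eq_rpow] at h4
    have h5 : t ≤ √m := Real.le_sqrt_of_sq_le hmt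
    have hl0 := Real.rpow_nonneg (log_add_three_nonneg m) (1 / γ)
    calc t * Real.log (m + 3) ^ (1 / γ) ≤ √m * √m := by gcongr
      _ = m := Real.mul_self_sqrt hm0
      _ ≤ (3 ^ (1 / γ) + 1) * m := by nlinarith

theorem eventually_layerBound_le {γ : ℝ} (hγ : 0 < γ) {C D : ℝ} (hC : 0 ≤ C) (hD : 0 ≤ D) :
    ∀ᶠ t : ℝ in atTop, ∀ m : ℕ, radius γ t ≤ m →
      layerBound D (logGrowth C (1 / γ)) t m ≤ Real.exp (-2 * m) := by
  set K : ℝ := 3 ^ (1 / γ) + 1 with hK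
  have hlog : Tendsto (fun t => Real.log t ^ (1 / γ)) atTop atTop :=
    (tendsto_rpow_atTop (by positivity)).comp Real.tendsto_log_atTop
  filter_upwards [eventually_mul_log_rpow_le hγ, (tendsto_radius hγ).eventually_gt_atTop 0,
    hlog.eventually_ge_atTop (D * Real.exp (3 + C * K)), hlog.eventually_gt_atTop 0,
    eventually_gt_atTop 0] with t h1 h2 h3 h4 h0 m hm
  have hm0 : (0 : ℝ) < m := h2.trans_le hm
  have hfac : (1 : ℝ) / m.factorial ≤ Real.exp m / m ^ m := by
    rw [le_div_iff₀ (by positivity), one_div, inv_mul_eq_div]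
    exact Real.pow_div_factorial_le_exp m hm0.le m
  have hexp : Real.exp (t * logGrowth C (1 / γ) m) ≤ Real.exp (C * K * m) := by
    refine Real.exp_le_exp.2 ?_
    have := mul_le_mul_of_nonneg_left (h1 m hm) hC
    unfold logGrowth
    linarith
  -- In 3 + C K, the 1 pays for m! ≥ (m/e)^m, C K for the potential, and 2 is the decay rate left
  -- over.
  have hbase : D * t / m * Real.exp (1 + C * K) ≤ Real.exp (-2) := by
    have h5 : t * (D * Real.exp (3 + C * K)) ≤ m :=
      (mul_le_mul_of_nonneg_left h3 h0.le).trans hm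
    have h6 : Real.exp (3 + C * K) = Real.exp (1 + C * K) * Real.exp 2 := by
      rw [← Real.exp_add]
      ring_nf
    rw [div_mul_eq_mul_div, div_le_iff₀ hm0, Real.exp_neg, inv_mul_eq_div,
      le_div_iff₀ (Real.exp_pos 2)]
    rw [h6] at h5
    linarith
  calc layerBound D (logGrowth C (1 / γ)) t m
      = (D * t) ^ m * (1 / m.factorial) * Real.exp (t * logGrowth C (1 / γ) m) := by
        rw [layerBound, mul_one_div]
    _ ≤ (D * t) ^ m * (Real.exp m / m ^ m) * Real.exp (C * K * m) := by gcongr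
    _ = (D * t / m * Real.exp (1 + C * K)) ^ m := by
        rw [mul_pow (D * t / m), div_pow, ← Real.exp_nat_mul,
          show (m : ℝ) * (1 + C * K) = m + C * K * m by ring, Real.exp_add]
        ring
    _ ≤ Real.exp (-2) ^ m := by gcongr
    _ = Real.exp (-2 * m) := by
        rw [← Real.exp_nat_mul]
        ring_nf

/-- Walks that leave the macrobox carry mass `o(exp (-R_t))`. -/
theorem eventually_tsum_layerBound_le {γ : ℝ} (hγ : 0 < γ) {C D : ℝ} (hC : 0 ≤ C) (hD : 0 ≤ D)
    {c : ℝ} (hc : 0 < c) :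
    ∀ᶠ t : ℝ in atTop,
      ∑' m, layerBound D (logGrowth C (1 / γ)) t (m + (intRadius γ t + 1)) ≤
        c * Real.exp (-radius γ t) := by
  have hsmall : ∀ᶠ t in atTop, Real.exp (-radius γ t) ≤ c / 2 :=
    (Real.tendsto_exp_neg_atTop_nhds_zero.comp (tendsto_radius hγ)).eventually
      (eventually_le_nhds (by positivity))
  filter_upwards [eventually_layerBound_le hγ hC hD, hsmall, eventually_ge_atTop 0]
    with t h1 h2 h0
  have hle : ∀ m : ℕ, layerBound D (logGrowth C (1 / γ)) t (m + (intRadius γ t + 1)) ≤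
      Real.exp (-2 * radius γ t) * (1 / 2) ^ m := by
    intro m
    -- The first discarded layer already has more than R_t steps.
    have hR : radius γ t ≤ intRadius γ t + 1 := (Nat.lt_floor_add_one _).le
    have hm0 : (0 : ℝ) ≤ m := Nat.cast_nonneg m
    refine (h1 _ (by push_cast; linarith)).trans ?_
    have h3 : Real.exp (-1) ≤ 1 / 2 := by
      rw [Real.exp_neg, inv_le_comm₀ (Real.exp_pos 1) (by norm_num)]
      have := Real.add_one_le_exp 1
      norm_num at this ⊢
      linarith
    calc Real.exp (-2 * ((m + (intRadius γ t + 1) : ℕ) : ℝ))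
        ≤ Real.exp (-2 * radius γ t + m * (-1)) := by
          refine Real.exp_le_exp.2 ?_
          push_cast
          linarith
      _ = Real.exp (-2 * radius γ t) * Real.exp (-1) ^ m := by
          rw [Real.exp_add, Real.exp_nat_mul]
      _ ≤ Real.exp (-2 * radius γ t) * (1 / 2) ^ m := by gcongr
  have hsum : HasSum (fun m : ℕ => Real.exp (-2 * radius γ t) * (1 / 2 : ℝ) ^ m)
      (Real.exp (-2 * radius γ t) * 2) := hasSum_geometric_two.mul_left _
  have hsum' := hsum.summable.of_nonneg_of_le
    (fun m => by unfold layerBound; positivity) hle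
  calc ∑' m, layerBound D (logGrowth C (1 / γ)) t (m + (intRadius γ t + 1))
      ≤ Real.exp (-2 * radius γ t) * 2 := hasSum_le hle hsum'.hasSum hsum
    _ = 2 * Real.exp (-radius γ t) * Real.exp (-radius γ t) := by
        rw [mul_assoc, ← Real.exp_add, mul_comm]
        ring_nf
    _ ≤ c * Real.exp (-radius γ t) := by
        gcongr
        linarith

end Asymptotics

/-! ### Boxes, lattice steps and torus steps -/

section Box

variable {d : ℕ}

theorem mem_box {N : ℕ} {z : Fin d → ℤ} : z ∈ box d N ↔ ∀ i, -(N : ℤ) ≤ z i ∧ z i ≤ N := by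
  simp [box]

theorem box_mono : Monotone (box d) := by
  intro m n hmn z hz
  rw [mem_box] at hz ⊢
  intro i
  have := hz i
  omega

theorem card_box (N : ℕ) : (box d N).card = (2 * N + 1) ^ d := by
  rw [box, Fintype.card_piFinset]
  simp only [Int.card_Icc, Finset.prod_const, Finset.card_univ, Fintype.card_fin]
  congr 1
  omega

theorem wrap_mem_box (N : ℕ) (z : Fin d → ℤ) : wrap N z ∈ box d N := by
  rw [mem_box]
  intro i
  have h1 := Int.le_bmod (x := z i) (m := 2 * N + 1) (by omega)
  have h2 := Int.bmod_le (x := z i) (m := 2 * N + 1) (by omega)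
  simp only [wrap]
  omega

theorem wrap_of_mem_box {N : ℕ} {z : Fin d → ℤ} (hz : z ∈ box d N) : wrap N z = z := by
  rw [mem_box] at hz
  funext i
  have := hz i
  exact Int.bmod_eq_of_le_mul_two (by omega) (by omega)

theorem wrap_wrap_add (N : ℕ) (z e : Fin d → ℤ) : wrap N (wrap N z + e) = wrap N (z + e) := by
  funext i
  simp only [wrap, Pi.add_apply]
  exact Int.bmod_add_bmod

/-- The unit vectors `± e_i`. -/
def direction : Fin d × Bool → (Fin d → ℤ)
  | (i, true) => Pi.single i 1
  | (i, false) => -Pi.single i 1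

theorem direction_mem (j : Fin d × Bool) (i : Fin d) : -1 ≤ direction j i ∧ direction j i ≤ 1 := by
  obtain ⟨k, b⟩ := j
  rcases eq_or_ne i k with rfl | h
  · cases b <;> simp [direction]
  · cases b <;> simp [direction, h]

theorem add_direction_mem_box {m : ℕ} {z : Fin d → ℤ} (hz : z ∈ box d m) (j : Fin d × Bool) :
    z + direction j ∈ box d (m + 1) := by
  rw [mem_box] at hz ⊢
  intro i
  have h1 := hz i
  have h2 := direction_mem j i
  simp only [Pi.add_apply]
  omega

theorem sub_direction_mem_box {m : ℕ} {z : Fin d → ℤ} (hz : z ∈ box d m) (j : Fin d × Bool) :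
    z - direction j ∈ box d (m + 1) := by
  rw [mem_box] at hz ⊢
  intro i
  have h1 := hz i
  have h2 := direction_mem j i
  simp only [Pi.sub_apply]
  omega

/-- The translation of `ℤ^d` by a unit vector. -/
def latticeStep (j : Fin d × Bool) : Equiv.Perm (Fin d → ℤ) := Equiv.addRight (direction j)

/-- The translation by a unit vector on the periodic box, extended by the identity. -/
noncomputable def torusStep (N : ℕ) (j : Fin d × Bool) : Equiv.Perm (Fin d → ℤ) where
  toFun z := if z ∈ box d N then wrap N (z + direction j) else z
  invFun z := if z ∈ box d N then wrap N (z - direction j) else z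
  left_inv z := by
    by_cases hz : z ∈ box d N
    · simp only [hz, if_true, wrap_mem_box]
      rw [sub_eq_add_neg, wrap_wrap_add, add_neg_cancel_right, wrap_of_mem_box hz]
    · simp only [hz, if_false]
  right_inv z := by
    by_cases hz : z ∈ box d N
    · simp only [hz, if_true, wrap_mem_box]
      rw [wrap_wrap_add, sub_add_cancel, wrap_of_mem_box hz]
    · simp only [hz, if_false]

theorem latticeStep_apply (j : Fin d × Bool) (z : Fin d → ℤ) :
    latticeStep j z = z + direction j := rfl

theorem torusStep_of_mem {N : ℕ} {z : Fin d → ℤ} (hz : z ∈ box d N) (j : Fin d × Bool) :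
    torusStep N j z = wrap N (z + direction j) := if_pos hz

theorem torusStep_of_notMem {N : ℕ} {z : Fin d → ℤ} (hz : z ∉ box d N) (j : Fin d × Bool) :
    torusStep N j z = z := if_neg hz

theorem torusStep_mem_box_iff {N : ℕ} {z : Fin d → ℤ} (j : Fin d × Bool) :
    torusStep N j z ∈ box d N ↔ z ∈ box d N := by
  by_cases hz : z ∈ box d N
  · simp only [torusStep_of_mem hz, wrap_mem_box, hz]
  · rw [torusStep_of_notMem hz]

/-- A step landing strictly inside the box of size N starts in that box and needs no wrapping. -/
theorem torusStep_eq_latticeStep {N m : ℕ} (hm : m < N) (j : Fin d × Bool) (z : Fin d → ℤ)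
    (h : latticeStep j z ∈ box d m ∨ torusStep N j z ∈ box d m) :
    latticeStep j z = torusStep N j z := by
  rcases h with h | h
  · have hz : z ∈ box d N := by
      have := box_mono hm (sub_direction_mem_box h j)
      rwa [latticeStep_apply, add_sub_cancel_right] at this
    rw [torusStep_of_mem hz, ← latticeStep_apply, wrap_of_mem_box (box_mono hm.le h)]
  · have hz : z ∈ box d N := (torusStep_mem_box_iff j).1 (box_mono hm.le h)
    rw [torusStep_of_mem hz] at h ⊢
    have h1 := wrap_of_mem_box (box_mono hm (sub_direction_mem_box h j))
    rw [sub_eq_add_neg, wrap_wrap_add, add_neg_cancel_right, wrap_of_mem_box hz] at h1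
    rw [latticeStep_apply]
    nth_rewrite 1 [h1]
    abel

theorem sum_latticeStep (f : (Fin d → ℤ) → ℝ) (z : Fin d → ℤ) :
    ∑ j, f (latticeStep j z) = laplacian f z := by
  simp [Fintype.sum_prod_type, laplacian, latticeStep_apply, direction, sub_eq_add_neg]

theorem sum_torusStep {N : ℕ} (f : (Fin d → ℤ) → ℝ) {z : Fin d → ℤ} (hz : z ∈ box d N) :
    ∑ j, f (torusStep N j z) = torusLaplacian N f z := by
  simp [Fintype.sum_prod_type, torusLaplacian, torusStep_of_mem hz, direction, sub_eq_add_neg]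

theorem walk_latticeStep_mem_box {m : ℕ} {z : Fin d → ℤ} (hz : z ∈ box d m)
    (l : List (Fin d × Bool)) : walk (fun j => latticeStep j) z l ∈ box d (m + l.length) := by
  induction l generalizing m z with
  | nil => exact hz
  | cons j l ih =>
    have := ih (add_direction_mem_box hz j)
    rw [add_assoc, add_comm 1] at this
    exact this

theorem exists_mem_box (z : Fin d → ℤ) : ∃ m, z ∈ box d m := by
  refine ⟨∑ i, (z i).natAbs, mem_box.2 fun i => ?_⟩
  have := Finset.single_le_sum (f := fun i => (z i).natAbs) (fun i _ => Nat.zero_le _)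
    (Finset.mem_univ i)
  omega

end Box

/-! ### Almost sure growth of the potential -/

section Growth

/-- The reason for the shift by 3 > e: a constant multiple of the growth function can dominate
finitely many values. -/
theorem one_le_log_add_three (m : ℕ) : 1 ≤ Real.log ((m : ℝ) + 3) := by
  rw [Real.le_log_iff_exp_le (by positivity)]
  have := Real.exp_one_lt_d9
  have := Nat.cast_nonneg (α := ℝ) m
  linarith

variable {Ω : Type*} [MeasurableSpace Ω] {P : Measure Ω} {d : ℕ} {γ : ℝ}
  {ξ : (Fin d → ℤ) → Ω → ℝ}

/-- At this threshold each site has tail probability (m + 3)^{-(d+2)}; the union bound over (2m +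
1)^d sites leaves a summable quantity. -/
theorem measure_exists_mem_box_lt (hγ : 0 < γ)
    (htail : ∀ z, ∀ x : ℝ, 0 ≤ x → P {ω | x < ξ z ω} = ENNReal.ofReal (Real.exp (-(x ^ γ))))
    (m : ℕ) :
    P {ω | ∃ z ∈ box d m, (((d : ℝ) + 2) * Real.log (m + 3)) ^ (1 / γ) < ξ z ω} ≤
      ENNReal.ofReal (2 ^ d * (1 / ((m + 3 : ℕ) : ℝ) ^ 2)) := by
  have hl := log_add_three_nonneg m
  set x : ℝ := (((d : ℝ) + 2) * Real.log (m + 3)) ^ (1 / γ) with hx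
  have hx0 : 0 ≤ x := by positivity
  have hxγ : Real.exp (-(x ^ γ)) = 1 / ((m : ℝ) + 3) ^ (d + 2) := by
    rw [hx, ← Real.rpow_mul (by positivity), one_div_mul_cancel hγ.ne', Real.rpow_one,
      Real.exp_neg, one_div]
    congr 1
    have : ((d : ℝ) + 2) * Real.log (m + 3) = Real.log (((m : ℝ) + 3) ^ (d + 2)) := by
      rw [Real.log_pow]
      push_cast
      ring
    rw [this, Real.exp_log (by positivity)]
  have hset : {ω | ∃ z ∈ box d m, x < ξ z ω} = ⋃ z ∈ box d m, {ω | x < ξ z ω} := by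
    ext ω
    simp
  rw [hset]
  refine (measure_biUnion_finset_le _ _).trans ?_
  simp only [fun z => htail z x hx0, Finset.sum_const, card_box, hxγ, nsmul_eq_mul]
  rw [← ENNReal.ofReal_natCast, ← ENNReal.ofReal_mul (Nat.cast_nonneg _)]
  refine ENNReal.ofReal_le_ofReal ?_
  push_cast
  rw [mul_one_div, pow_add, mul_one_div, div_le_div_iff₀ (by positivity) (by positivity)]
  have h1 : (2 * (m : ℝ) + 1) ^ d ≤ (2 * (m + 3)) ^ d := by
    gcongr
    linarith
  rw [mul_pow] at h1
  have := mul_le_mul_of_nonneg_right h1 (show (0 : ℝ) ≤ (m + 3) ^ 2 by positivity)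
  linarith

/-- Almost surely, the potential is non-negative and of order `(log |z|)^{1/γ}`. -/
theorem ae_le_logGrowth [IsProbabilityMeasure P] (hγ : 0 < γ) (hmeas : ∀ z, Measurable (ξ z))
    (htail : ∀ z, ∀ x : ℝ, 0 ≤ x → P {ω | x < ξ z ω} = ENNReal.ofReal (Real.exp (-(x ^ γ)))) :
    ∀ᵐ ω ∂P, (∀ z, 0 ≤ ξ z ω) ∧
      ∃ C : ℝ, 0 ≤ C ∧ ∀ m, ∀ z ∈ box d m, ξ z ω ≤ logGrowth C (1 / γ) m := by
  have hpos : ∀ᵐ ω ∂P, ∀ z, 0 ≤ ξ z ω := by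
    rw [ae_all_iff]
    intro z
    have h1 : ∀ᵐ ω ∂P, 0 < ξ z ω := by
      refine (mem_ae_iff_prob_eq_one (measurableSet_lt measurable_const (hmeas z))).2 ?_
      rw [htail z 0 le_rfl, Real.zero_rpow hγ.ne']
      simp
    exact h1.mono fun ω h => h.le
  have hsum : Summable fun m : ℕ => (2 : ℝ) ^ d * (1 / ((m + 3 : ℕ) : ℝ) ^ 2) :=
    ((summable_nat_add_iff 3).2 (Real.summable_one_div_nat_pow.2 one_lt_two)).mul_left _
  have hBC := ae_eventually_notMem (ne_top_of_le_ne_top hsum.tsum_ofReal_ne_top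
    (ENNReal.tsum_le_tsum (measure_exists_mem_box_lt hγ htail)))
  filter_upwards [hpos, hBC] with ω h0 hev
  refine ⟨h0, ?_⟩
  obtain ⟨m₀, hm₀⟩ := eventually_atTop.1 hev
  have hS : 0 ≤ ∑ z ∈ box d m₀, ξ z ω := Finset.sum_nonneg fun z _ => h0 z
  have hp : 0 < 1 / γ := by positivity
  -- The first summand handles the boxes m ≥ m₀ of Borel–Cantelli, the sum handles the finitely many
  -- smaller ones.
  refine ⟨((d : ℝ) + 2) ^ (1 / γ) + ∑ z ∈ box d m₀, ξ z ω, by positivity, fun m z hz => ?_⟩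
  have hl := Real.one_le_rpow (one_le_log_add_three m) hp.le
  have hd0 : 0 ≤ ((d : ℝ) + 2) ^ (1 / γ) := by positivity
  unfold logGrowth
  rcases le_total m₀ m with hm | hm
  · have h1 := hm₀ m hm
    simp only [not_exists, not_and, not_lt] at h1
    refine (h1 z hz).trans ?_
    rw [Real.mul_rpow (by positivity) (log_add_three_nonneg m)]
    gcongr
    linarith
  · have h1 := Finset.single_le_sum (f := fun z => ξ z ω) (fun z _ => h0 z) (box_mono hm hz)
    nlinarith

end Growth

/-! ### The lattice and torus solutions and their comparison -/

section Solutions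

variable {d : ℕ}

/-- The initial condition with values in `ℝ≥0`. -/
def originMass (d : ℕ) : (Fin d → ℤ) → ℝ≥0 := Pi.single 0 1

theorem coe_originMass (z : Fin d → ℤ) : (originMass d z : ℝ) = originIndicator d z := by
  rw [originMass, originIndicator, Pi.single_apply, Pi.single_apply]
  split_ifs <;> simp

theorem eq_zero_of_originMass_ne_zero {z : Fin d → ℤ} (h : originMass d z ≠ 0) : z = 0 := by
  by_contra hz
  exact h (Pi.single_eq_of_ne hz 1)

theorem tsum_originMass_le : ∑' z, (originMass d z : ℝ≥0∞) ≤ 1 := by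
  rw [tsum_eq_single 0 fun z hz => ?_]
  · simp [originMass]
  · rw [originMass, Pi.single_eq_of_ne hz, ENNReal.coe_zero]

theorem originMass_support (m : ℕ) {z : Fin d → ℤ} (h : originMass d z ≠ 0) : z ∈ box d m := by
  rw [eq_zero_of_originMass_ne_zero h, mem_box]
  intro i
  simp

/-- The potential on the periodic box, extended by zero. -/
noncomputable def torusPotential (N : ℕ) (q : (Fin d → ℤ) → ℝ) (z : Fin d → ℤ) : ℝ≥0 :=
  if z ∈ box d N then (q z).toNNReal else 0

/-- The solution on the lattice. -/
noncomputable def latticeSolution (q : (Fin d → ℤ) → ℝ) : ℝ → (Fin d → ℤ) → ℝ :=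
  semigroup (fun j => latticeStep j) (fun z => (q z).toNNReal) (originMass d)

/-- The solution on the periodic box. -/
noncomputable def torusSolution (N : ℕ) (q : (Fin d → ℤ) → ℝ) : ℝ → (Fin d → ℤ) → ℝ :=
  semigroup (fun j => torusStep N j) (torusPotential N q) (originMass d)

variable {q : (Fin d → ℤ) → ℝ} {M : ℕ → ℝ}

theorem controlled_lattice (hM : ∀ m, ∀ z ∈ box d m, q z ≤ M m) (hM0 : ∀ m, 0 ≤ M m)
    (hMo : ∀ ε : ℝ, 0 < ε → ∀ᶠ n : ℕ in atTop, M n ≤ ε * n) :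
    Controlled (latticeStep (d := d)) (fun z => (q z).toNNReal) (originMass d)
      (fun m => ↑(box d m)) M where
  exhausts :=
    { support := fun z hz => originMass_support 0 hz
      mono := fun m n hmn => Finset.coe_subset.2 (box_mono hmn)
      step := fun m j z hz => by
        have := sub_direction_mem_box (Finset.mem_coe.1 hz) j
        rwa [latticeStep_apply, add_sub_cancel_right] at this }
  mass_le := tsum_originMass_le
  le := fun m z hz => by
    rw [Real.coe_toNNReal']
    exact max_le (hM m z hz) (hM0 m)
  nonneg := hM0
  summable := fun t ht => summable_layerBound (Nat.cast_nonneg _) ht hM0 hMo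

theorem controlled_torus (hM : ∀ m, ∀ z ∈ box d m, q z ≤ M m) (hM0 : ∀ m, 0 ≤ M m)
    (hMo : ∀ ε : ℝ, 0 < ε → ∀ᶠ n : ℕ in atTop, M n ≤ ε * n) (N : ℕ) :
    Controlled (torusStep (d := d) N) (torusPotential N q) (originMass d)
      (fun m => ↑(box d (min m N))) M where
  exhausts :=
    { support := fun z hz => originMass_support _ hz
      mono := fun m n hmn => Finset.coe_subset.2 (box_mono (min_le_min_right N hmn))
      step := fun m j z hz => by
        simp only [Finset.mem_coe] at hz ⊢
        rcases Nat.lt_or_ge m N with h | h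
        · rw [min_eq_left h.le] at hz
          rw [min_eq_left (by omega : m + 1 ≤ N)]
          rw [← torusStep_eq_latticeStep h j z (Or.inr hz)] at hz
          have := sub_direction_mem_box hz j
          rwa [latticeStep_apply, add_sub_cancel_right] at this
        · rw [min_eq_right h] at hz
          rw [min_eq_right (by omega)]
          exact (torusStep_mem_box_iff j).1 hz }
  mass_le := tsum_originMass_le
  le := fun m z hz => by
    rw [torusPotential, if_pos (box_mono (min_le_right _ _) hz), Real.coe_toNNReal']
    exact max_le (hM m z (box_mono (min_le_left _ _) hz)) (hM0 m)
  nonneg := hM0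
  summable := fun t ht => summable_layerBound (Nat.cast_nonneg _) ht hM0 hMo

theorem isSolution_latticeSolution (hq : ∀ z, 0 ≤ q z) (hM : ∀ m, ∀ z ∈ box d m, q z ≤ M m)
    (hM0 : ∀ m, 0 ≤ M m) (hMo : ∀ ε : ℝ, 0 < ε → ∀ᶠ n : ℕ in atTop, M n ≤ ε * n) :
    IsSolution q (latticeSolution q) where
  nonneg := fun t ht z => Controlled.semigroup_nonneg ht z
  initial := by
    funext z
    exact (Controlled.semigroup_zero z).trans (coe_originMass z)
  hasDeriv := fun t ht z => by
    have h := (controlled_lattice hM hM0 hMo).hasDerivAt_semigroup ht z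
    rw [sum_latticeStep, Real.coe_toNNReal _ (hq z)] at h
    exact h.hasDerivWithinAt

theorem IsSolution.eqOn (hq : ∀ z, 0 ≤ q z) (hM : ∀ m, ∀ z ∈ box d m, q z ≤ M m)
    (hM0 : ∀ m, 0 ≤ M m) (hMmono : Monotone M)
    (hMo : ∀ (k : ℕ) (ε : ℝ), 0 < ε → ∀ᶠ n : ℕ in atTop, M (k + n) ≤ ε * n)
    {u v : ℝ → (Fin d → ℤ) → ℝ} (hu : IsSolution q u) (hv : IsSolution q v) :
    Set.EqOn v u (Set.Ici 0) := by
  intro s hs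
  funext z
  obtain ⟨k, hk⟩ := exists_mem_box z
  refine eq_of_nonneg_of_sublinear (σ := fun j => latticeStep j) (M := fun n => M (k + n)) hq
    (fun z => by rw [hu.initial, hv.initial]) hv.nonneg hu.nonneg (fun t ht z => ?_)
    (fun t ht z => ?_) z (fun n => hM0 _) (fun n l hl => ?_) (hMo k) hs
  · rw [sum_latticeStep]
    exact hv.hasDeriv t ht z
  · rw [sum_latticeStep]
    exact hu.hasDeriv t ht z
  · exact (hM _ _ (walk_latticeStep_mem_box hk l)).trans (hMmono (by omega))

theorem isTorusSolution_torusSolution (hq : ∀ z, 0 ≤ q z) (hM : ∀ m, ∀ z ∈ box d m, q z ≤ M m)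
    (hM0 : ∀ m, 0 ≤ M m) (hMo : ∀ ε : ℝ, 0 < ε → ∀ᶠ n : ℕ in atTop, M n ≤ ε * n) (N : ℕ) :
    IsTorusSolution N q (torusSolution N q) where
  zero_outside := fun s hs z hz => by
    refine (controlled_torus hM hM0 hMo N).semigroup_eq_zero hs fun m hm => ?_
    exact hz (box_mono (min_le_right m N) hm)
  initial := by
    funext z
    exact (Controlled.semigroup_zero z).trans (coe_originMass z)
  hasDeriv := fun t ht z hz => by
    have h := (controlled_torus hM hM0 hMo N).hasDerivAt_semigroup ht z
    rw [sum_torusStep _ hz, torusPotential, if_pos hz, Real.coe_toNNReal _ (hq z)] at h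
    exact h.hasDerivWithinAt

/-- Extending the torus steps by the identity and the potential by 0 turns the torus equation into a
system on all of ℤ^d: outside the box both sides are 0. -/
theorem IsTorusSolution.hasDerivWithinAt {N : ℕ} {v : ℝ → (Fin d → ℤ) → ℝ}
    (hv : IsTorusSolution N q v) (hq : ∀ z, 0 ≤ q z) {t : ℝ} (ht : 0 ≤ t) (z : Fin d → ℤ) :
    HasDerivWithinAt (fun s => v s z)
      (∑ j, v t (torusStep N j z) + torusPotential N q z * v t z) (Set.Ici 0) t := by
  by_cases hz : z ∈ box d N
  · rw [sum_torusStep _ hz, torusPotential, if_pos hz, Real.coe_toNNReal _ (hq z)]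
    exact hv.hasDeriv t ht z hz
  · simp only [torusStep_of_notMem hz, hv.zero_outside t ht z hz, mul_zero, Finset.sum_const_zero,
      add_zero]
    exact (hasDerivWithinAt_const t _ (0 : ℝ)).congr
      (fun s hs => hv.zero_outside s hs z hz) (hv.zero_outside t ht z hz)

theorem IsTorusSolution.eqOn {N : ℕ} (hq : ∀ z, 0 ≤ q z)
    (hM : ∀ m, ∀ z ∈ box d m, q z ≤ M m) (hM0 : ∀ m, 0 ≤ M m)
    {u v : ℝ → (Fin d → ℤ) → ℝ} (hu : IsTorusSolution N q u) (hv : IsTorusSolution N q v) :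
    Set.EqOn v u (Set.Ici 0) := by
  intro s hs
  have hbdd : ∀ z, ∃ B : ℝ, ∀ r ∈ Set.Icc 0 s, |v r z - u r z| ≤ B := fun z =>
    isCompact_Icc.exists_bound_of_continuousOn fun r hr =>
      (((hv.hasDerivWithinAt hq hr.1 z).continuousWithinAt.sub
        (hu.hasDerivWithinAt hq hr.1 z).continuousWithinAt).mono fun x hx => hx.1)
  choose B hB using hbdd
  have hB0 : ∀ z, 0 ≤ B z := fun z => (abs_nonneg _).trans (hB z 0 ⟨le_rfl, hs⟩)
  funext z
  -- Continuity bounds the difference on [0, s] at each site; summing over the finite box gives one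
  -- bound for all sites.
  refine eq_of_bounded (σ := fun j => torusStep N j) (q := fun z => torusPotential N q z)
    (M := M N) (B := ∑ z ∈ box d N, B z) (fun z => by rw [hu.initial, hv.initial])
    (fun t ht z => hv.hasDerivWithinAt hq ht z) (fun t ht z => hu.hasDerivWithinAt hq ht z)
    (hM0 N) (fun z => ?_) hs (fun r hr z => ?_) z
  · by_cases hz : z ∈ box d N
    · rw [torusPotential, if_pos hz, Real.coe_toNNReal _ (hq z)]
      exact hM N z hz
    · rw [torusPotential, if_neg hz]
      exact hM0 N
  · by_cases hz : z ∈ box d N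
    · exact (hB z r hr).trans (Finset.single_le_sum (fun z _ => hB0 z) hz)
    · rw [hu.zero_outside r hr.1 z hz, hv.zero_outside r hr.1 z hz, sub_zero, abs_zero]
      exact Finset.sum_nonneg fun z _ => hB0 z

theorem abs_torusSolution_sub_le (hM : ∀ m, ∀ z ∈ box d m, q z ≤ M m) (hM0 : ∀ m, 0 ≤ M m)
    (hMo : ∀ ε : ℝ, 0 < ε → ∀ᶠ n : ℕ in atTop, M n ≤ ε * n) (N : ℕ) {t : ℝ} (ht : 0 ≤ t) :
    (∀ z, |torusSolution N q t z - latticeSolution q t z| ≤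
      ∑' m, layerBound (Fintype.card (Fin d × Bool)) M t (m + (N + 1))) ∧
    |∑ z ∈ box d N, torusSolution N q t z - ∑' z, latticeSolution q t z| ≤
      ∑' m, layerBound (Fintype.card (Fin d × Bool)) M t (m + (N + 1)) := by
  have hT := controlled_torus hM hM0 hMo N
  obtain ⟨h1, h2⟩ := abs_semigroup_sub_le (controlled_lattice hM hM0 hMo) hT (N := N)
    (fun z hz => by rw [torusPotential, if_pos (Finset.mem_coe.1 hz)])
    (fun m hm j z hz => torusStep_eq_latticeStep hm j z hz) ht
  have h3 : ∑ z ∈ box d N, torusSolution N q t z = ∑' z, torusSolution N q t z :=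
    (tsum_eq_sum fun z hz => hT.semigroup_eq_zero ht fun m hm =>
      hz (box_mono (min_le_right m N) hm)).symm
  rw [h3]
  exact ⟨fun z => (abs_sub_comm _ _).trans_le (h1 z), (abs_sub_comm _ _).trans_le h2⟩

end Solutions

end PAM

/-! ### Almost sure comparison of the two models -/

theorem proposition2p1 {Ω : Type*} [MeasurableSpace Ω] (P : Measure Ω) [IsProbabilityMeasure P]
    (d : ℕ) (hd : 1 ≤ d) (γ : ℝ) (hγ : 0 < γ)
    (ξ : (Fin d → ℤ) → Ω → ℝ) (hmeas : ∀ z, Measurable (ξ z)) (hindep : iIndepFun ξ P)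
    (htail : ∀ z, ∀ x : ℝ, 0 ≤ x → P {ω | x < ξ z ω} = ENNReal.ofReal (Real.exp (-(x ^ γ)))) :
    ∀ᵐ ω ∂P, ∃ (u : ℝ → (Fin d → ℤ) → ℝ) (uV : ℝ → ℝ → (Fin d → ℤ) → ℝ),
      -- `u` is the unique non-negative solution on the lattice, and its total mass is finite
      (PAM.IsSolution (fun z => ξ z ω) u ∧
        (∀ v, PAM.IsSolution (fun z => ξ z ω) v → Set.EqOn v u (Set.Ici 0)) ∧
        ∀ t, 0 ≤ t → Summable (u t)) ∧
      -- for each `t`, `uV t` is the unique solution on the macrobox `V_t`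
      (∀ t, PAM.IsTorusSolution (PAM.intRadius γ t) (fun z => ξ z ω) (uV t) ∧
        ∀ v, PAM.IsTorusSolution (PAM.intRadius γ t) (fun z => ξ z ω) v →
          Set.EqOn v (uV t) (Set.Ici 0)) ∧
      -- the two solutions at time `t` differ by `o(exp (-R_t))`, uniformly in `z`
      (∀ c : ℝ, 0 < c → ∀ᶠ t in atTop, ∀ z,
        |uV t t z - u t z| ≤ c * Real.exp (-PAM.radius γ t)) ∧
      -- so do their total masses
      (fun t => (∑ z ∈ PAM.box d (PAM.intRadius γ t), uV t t z) - ∑' z, u t z)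
        =o[atTop] fun t => Real.exp (-PAM.radius γ t) := by
  filter_upwards [PAM.ae_le_logGrowth hγ hmeas htail] with ω hω
  obtain ⟨hq, C, hC, hM⟩ := hω
  have hp : 0 ≤ 1 / γ := by positivity
  have hM0 := PAM.logGrowth_nonneg hC (1 / γ)
  have hMk : ∀ (k : ℕ) (ε : ℝ), 0 < ε → ∀ᶠ n : ℕ in atTop,
      PAM.logGrowth C (1 / γ) (k + n) ≤ ε * n :=
    fun k ε hε => PAM.logGrowth_add_sublinear hC (1 / γ) k hε
  have hMo : ∀ ε : ℝ, 0 < ε → ∀ᶠ n : ℕ in atTop, PAM.logGrowth C (1 / γ) n ≤ ε * n := by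
    simpa only [zero_add] using hMk 0
  have hu := PAM.isSolution_latticeSolution hq hM hM0 hMo
  have huV := PAM.isTorusSolution_torusSolution hq hM hM0 hMo
  have hε := fun (c : ℝ) (hc : 0 < c) => PAM.eventually_tsum_layerBound_le hγ hC
    (Nat.cast_nonneg (α := ℝ) (Fintype.card (Fin d × Bool))) hc
  refine ⟨PAM.latticeSolution fun z => ξ z ω,
    fun t => PAM.torusSolution (PAM.intRadius γ t) fun z => ξ z ω,
    ⟨hu, fun v hv => PAM.IsSolution.eqOn hq hM hM0 (PAM.logGrowth_mono hC hp) hMk hu hv,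
      fun t ht => (PAM.controlled_lattice hM hM0 hMo).summable_semigroup ht⟩,
    fun t => ⟨huV _, fun v hv => PAM.IsTorusSolution.eqOn hq hM hM0 (huV _) hv⟩,
    fun c hc => ?_, IsLittleO.of_bound fun c hc => ?_⟩
  · filter_upwards [hε c hc, eventually_ge_atTop 0] with t h1 h0 z
    exact ((PAM.abs_torusSolution_sub_le hM hM0 hMo _ h0).1 z).trans h1
  · filter_upwards [hε c hc, eventually_ge_atTop 0] with t h1 h0
    rw [Real.norm_of_nonneg (Real.exp_nonneg _)]
    exact (PAM.abs_torusSolution_sub_le hM hM0 hMo _ h0).2.trans h1
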